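/- Let $n\ge 1$, $c\in(0,1]$, $\alpha\in[0,1)$, and let $0<\omega_n<\cdots<\omega_1<1$ and $c_1,\dots,c_n>0$ with $\sum_{i=1}^n c_i=1$ (for instance the Gauss–Legendre nodes and weights on $[0,1]$). Put $$\delta_i=\frac1{c\,\omega_i(1+\alpha)},\quad \gamma_i=\frac1{c\,\omega_i(1-\alpha)},\quad q_i=\frac{c_i}{2\omega_i},\quad P=\Big(\frac{q_j}{\delta_i+\gamma_j}\Big)_{n\times n},\quad \widetilde P=\Big(\frac{q_j}{\gamma_i+\delta_j}\Big)_{n\times n},$$ let $e=(1,\dots,1)^\top\in\mathbb R^n$, let $\circ$ be the componentwise product, and define $f:\mathbb R^{2n}\to\mathbb R^{2n}$ by $$f(u,v)=\begin{bmatrix}u-u\circ(Pv)-e\\ v-v\circ(\widetilde Pu)-e\end{bmatrix}.$$ Let $x^*$ be the minimal positive solution of $f(x)=0$, that is, the componentwise positive solution that is componentwise less than or equal to every componentwise positive solution. Consider the two-step modified Newton method with $x_0=0$, $z_{-1}=x_0$ and, for $k\ge 0$, $$y_k=x_k-f'(z_{k-1})^{-1}f(x_k),\qquad z_k=\tfrac12(x_k+y_k),\qquad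 x_{k+1}=x_k-f'(z_k)^{-1}f(x_k).$$ Suppose that $\alpha\ne 0$ or $c\ne 1$ (the case in which $f'(x^*)$ is nonsingular), and that $c(1+\alpha)\le 1/3$. Then: 1. the method is well defined (every $f'(z_{k-1})$, $k\ge 0$, is invertible) and $x_k$ converges Q-quadratically to $x^*$, i.e. $x_k\to x^*$ and there is a constant $M>0$ with $\|x_{k+1}-x^*\|_\infty\le M\|x_k-x^*\|_\infty^2$ for all $k\ge 0$; 2. $\|x^*-x_k\|_\infty<1.32\,c(1+\alpha)\,\|x_k-x_{k-1}\|_\infty^2$ for all $k\ge 1$; 3. $x^*$ lies in the open ball $B(0,r)=\{x:\|x\|_\infty<r\}$ for every real $r$ with $$\frac{1-\sqrt{1-2c(1+\alpha)}}{c(1+\alpha)}\le r<\frac{1+\sqrt{1-2c(1+\alpha)}}{c(1+\alpha)}.$$ -/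

import Mathlib

open Filter Topology

noncomputable section

namespace TransportRiccati

/-- `ℝ²ⁿ`, with vectors written as `x = [u; v]`: the `u`-entries are the `Sum.inl i` coordinates,
the `v`-entries the `Sum.inr i` coordinates. Its norm is the sup-norm `‖·‖_∞`. -/
abbrev Vec (n : ℕ) : Type := Fin n ⊕ Fin n → ℝ

variable {n : ℕ}

/-- `δ_i = 1 / (c ω_i (1 + α))`. -/
def delta (c α : ℝ) (ω : Fin n → ℝ) (i : Fin n) : ℝ := 1 / (c * ω i * (1 + α))

/-- `γ_i = 1 / (c ω_i (1 - α))`. -/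
def gamma (c α : ℝ) (ω : Fin n → ℝ) (i : Fin n) : ℝ := 1 / (c * ω i * (1 - α))

/-- `q_i = c_i / (2 ω_i)`, where the quadrature weights `c_i` are called `w i`. -/
def q (ω w : Fin n → ℝ) (i : Fin n) : ℝ := w i / (2 * ω i)

/-- `P = (q_j / (δ_i + γ_j))`. -/
def P (c α : ℝ) (ω w : Fin n → ℝ) : Matrix (Fin n) (Fin n) ℝ :=
  Matrix.of fun i j => q ω w j / (delta c α ω i + gamma c α ω j)

/-- `P̃ = (q_j / (γ_i + δ_j))`. -/
def Ptilde (c α : ℝ) (ω w : Fin n → ℝ) : Matrix (Fin n) (Fin n) ℝ :=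
  Matrix.of fun i j => q ω w j / (gamma c α ω i + delta c α ω j)

/-- `f(u, v) = [u - u ∘ (P v) - e; v - v ∘ (P̃ u) - e]`. -/
def f (c α : ℝ) (ω w : Fin n → ℝ) (x : Vec n) : Vec n :=
  let u : Fin n → ℝ := fun i => x (Sum.inl i)
  let v : Fin n → ℝ := fun i => x (Sum.inr i)
  Sum.elim (fun i => u i - u i * (P c α ω w).mulVec v i - 1)
    (fun i => v i - v i * (Ptilde c α ω w).mulVec u i - 1)

/-- `x` is the minimal positive solution of `f(x) = 0`: it is a componentwise positive solution
and is componentwise at most every other componentwise positive solution. -/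
def IsMinimalPositiveSolution (c α : ℝ) (ω w : Fin n → ℝ) (x : Vec n) : Prop :=
  IsLeast {y : Vec n | (∀ i, 0 < y i) ∧ f c α ω w y = 0} x

end TransportRiccati

namespace TwoStepNewton

variable {E : Type*} [NormedAddCommGroup E] [NormedSpace ℝ E]

/-- `y = x - g'(z_prev)⁻¹ g(x)`. -/
def predictor (g : E → E) (zprev x : E) : E :=
  x - (fderiv ℝ g zprev).inverse (g x)

/-- `z = (x + y) / 2`. -/
def midpoint (g : E → E) (zprev x : E) : E :=
  (1 / 2 : ℝ) • (x + predictor g zprev x)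

/-- One step `(x_k, z_{k-1}) ↦ (x_{k+1}, z_k)` of the two-step modified Newton method, with
`x_{k+1} = x_k - g'(z_k)⁻¹ g(x_k)`. -/
def step (g : E → E) (s : E × E) : E × E :=
  (s.1 - (fderiv ℝ g (midpoint g s.2 s.1)).inverse (g s.1), midpoint g s.2 s.1)

/-- The pair `(x_k, z_{k-1})`, starting from `x_0 = z_{-1} = x0`. -/
def state (g : E → E) (x0 : E) (k : ℕ) : E × E := (step g)^[k] (x0, x0)

/-- The iterate `x_k`. -/
def iter (g : E → E) (x0 : E) (k : ℕ) : E := (state g x0 k).1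

/-- The point `z_{k-1}` (so `k = 0` gives `z_{-1} = x_0`). -/
def zPrev (g : E → E) (x0 : E) (k : ℕ) : E := (state g x0 k).2

/-- The iterates are well defined: every Jacobian `g'(z_{k-1})`, `k ≥ 0`, that the method inverts
is invertible. -/
def WellDefined (g : E → E) (x0 : E) : Prop :=
  ∀ k : ℕ, (fderiv ℝ g (zPrev g x0 k)).IsInvertible

/-- Q-quadratic convergence `x_k → a`. -/
def ConvergesQQuadratically (x : ℕ → E) (a : E) : Prop :=
  Tendsto x atTop (𝓝 a) ∧ ∃ M : ℝ, 0 < M ∧ ∀ k : ℕ, ‖x (k + 1) - a‖ ≤ M * ‖x k - a‖ ^ 2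

end TwoStepNewton

end

/-!
The substitution `A(x, y) = b(x, y) + b(y, x)`, where `b` is the quadratic part of `f`, turns the
equation `f(x) = 0` into `x = e + A(x, x) / 2` with `A` a symmetric bilinear map that preserves
positivity and satisfies `A(e, e) < p e`, `p = c (1 + α)` (`isPositiveBilinear_polar`). Everything
is proved for such equations; write `g(x) = x - A(x, x) / 2 - e`, so `g'(x) = I - A(x)`, and let `a`
be the least positive zero of `g`.

*Size of `a`.* If `1 + p t² / 2 ≤ t`, then `x ↦ e + A(x, x) / 2` maps the order interval `[0, t e]`
into itself monotonically, so it has a fixed point there by Knaster–Tarski, and `‖a‖ < t` by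
minimality (`least_zero_lt`). The smaller root of `1 + p t² / 2 = t` gives the ball containing `a`;
for `p ≤ 1 / 3`, `t = 0.425 / p` is also admissible, so `p ‖a‖ ≤ 0.425`.

*Monotonicity.* For `0 ≤ z ≤ a`, `I - A(z)` is therefore a nonsingular M-matrix: invertible, with
nonnegative inverse of norm at most `1 / 0.575`. Since `g` is quadratic,
`-g(x) = (I - A(m)) (a - x)` with `m = (x + a) / 2`, and hence
`(I - A(z_{k-1})) (a - y_k) = A(m_k - z_{k-1}) (a - x_k)` and
`(I - A(z_k)) (a - x_{k+1}) = A(a - y_k) (a - x_k) / 2`.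
By induction `0 ≤ z_{k-1} ≤ x_k < a` and `g(x_k) ≤ 0` (`Invariant.step`), so every derivative the
method meets is invertible.

*Rate.* The two identities also give `‖a - y_k‖ ≤ (0.425 / 0.575) ‖a - x_k‖` and then
`‖a - x_{k+1}‖ ≤ 0.643 p ‖a - x_k‖²`. With `p ‖a - x_k‖ ≤ 0.425` this yields convergence,
Q-quadratic order, and, by the triangle inequality, the a posteriori bound with constant
`0.643 / 0.726² < 1.32` (`norm_sub_iter_succ_lt`).
-/

noncomputable section

/-! ### Quadratic equations with a positive bilinear form -/

namespace PositiveQuadratic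

open ContinuousLinearMap

variable {ι : Type*}

/-- `A` is a symmetric bilinear map on `ι → ℝ` that preserves nonnegativity and componentwise
positivity, and every component of `A(e, e)` is below `p`, where `e` is the all-ones vector. For a
nonnegative `A` the largest component of `A(e, e)` is its operator norm for the
sup-norm. -/
structure IsPositiveBilinear (A : (ι → ℝ) →L[ℝ] (ι → ℝ) →L[ℝ] (ι → ℝ)) (p : ℝ) : Prop where
  symm : ∀ x y, A x y = A y x
  nonneg : ∀ x y, 0 ≤ x → 0 ≤ y → 0 ≤ A x y
  pos : ∀ x y, (∀ i, 0 < x i) → (∀ i, 0 < y i) → ∀ i, 0 < A x y i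
  one_one_lt : ∀ i, A 1 1 i < p

/-- The map `x ↦ x - A(x, x) / 2 - e`. -/
def quad (A : (ι → ℝ) →L[ℝ] (ι → ℝ) →L[ℝ] (ι → ℝ)) (x : ι → ℝ) : ι → ℝ :=
  x - (1 / 2 : ℝ) • A x x - 1

variable {A : (ι → ℝ) →L[ℝ] (ι → ℝ) →L[ℝ] (ι → ℝ)} {p : ℝ}

lemma norm_le_norm_of_nonneg_of_le [Fintype ι] {x y : ι → ℝ} (hx : 0 ≤ x) (hxy : x ≤ y) :
    ‖x‖ ≤ ‖y‖ := by
  refine (pi_norm_le_iff_of_nonneg (norm_nonneg _)).2 fun i => ?_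
  rw [Real.norm_of_nonneg (hx i)]
  exact (hxy i).trans ((le_abs_self _).trans (norm_le_pi_norm y i))

namespace IsPositiveBilinear

lemma mono (hA : IsPositiveBilinear A p) {x x' y y' : ι → ℝ} (hx : 0 ≤ x) (hxx : x ≤ x')
    (hy : 0 ≤ y) (hyy : y ≤ y') : A x y ≤ A x' y' := by
  have h1 := hA.nonneg (x' - x) y' (sub_nonneg.2 hxx) (hy.trans hyy)
  have h2 := hA.nonneg x (y' - y) hx (sub_nonneg.2 hyy)
  have : A x' y' - A x y = A (x' - x) y' + A x (y' - y) := by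
    simp only [map_sub, sub_apply]; abel
  exact sub_nonneg.1 (this ▸ add_nonneg h1 h2)

lemma pos_bound [Nonempty ι] (hA : IsPositiveBilinear A p) : 0 < p :=
  let i := Classical.arbitrary ι
  (hA.pos 1 1 (fun _ => one_pos) (fun _ => one_pos) i).trans (hA.one_one_lt i)

/-- The values of `quad A` at two points are compared by its derivative at their midpoint. -/
lemma quad_sub_quad (hA : IsPositiveBilinear A p) (x a : ι → ℝ) :
    quad A a - quad A x = (a - x) - A ((1 / 2 : ℝ) • (x + a)) (a - x) := by
  simp only [quad, map_add, map_sub, map_smul, add_apply, smul_apply, hA.symm a x]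
  module

variable [Fintype ι]

lemma norm_apply_le [Nonempty ι] (hA : IsPositiveBilinear A p) (x y : ι → ℝ) :
    ‖A x y‖ ≤ p * ‖x‖ * ‖y‖ := by
  have hp := hA.pos_bound
  have key (x : ι → ℝ) : 0 ≤ ‖x‖ • (1 : ι → ℝ) + x ∧ 0 ≤ ‖x‖ • (1 : ι → ℝ) - x := by
    constructor <;> intro i <;>
      have := abs_le.1 (norm_le_pi_norm x i) <;> simp <;> linarith
  obtain ⟨hx1, hx2⟩ := key x
  obtain ⟨hy1, hy2⟩ := key y
  refine (pi_norm_le_iff_of_nonneg (by positivity)).2 fun i => abs_le.2 ?_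
  -- `A(X ± x, Y ± y) ≥ 0` for `X = ‖x‖ e`, `Y = ‖y‖ e`; sums of two of these isolate `A(x, y)`
  have h1 := hA.nonneg _ _ hx1 hy1 i
  have h2 := hA.nonneg _ _ hx1 hy2 i
  have h3 := hA.nonneg _ _ hx2 hy1 i
  have h4 := hA.nonneg _ _ hx2 hy2 i
  simp only [map_add, map_sub, map_smul, add_apply, sub_apply, smul_apply, Pi.zero_apply,
    Pi.add_apply, Pi.sub_apply, Pi.smul_apply, smul_eq_mul] at h1 h2 h3 h4
  have h5 : ‖x‖ * (‖y‖ * A 1 1 i) ≤ p * ‖x‖ * ‖y‖ := by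
    have := mul_le_mul_of_nonneg_left (hA.one_one_lt i).le
      (mul_nonneg (norm_nonneg x) (norm_nonneg y))
    linarith
  constructor <;> linarith

lemma norm_le [Nonempty ι] (hA : IsPositiveBilinear A p) (z : ι → ℝ) : ‖A z‖ ≤ p * ‖z‖ :=
  opNorm_le_bound _ (mul_nonneg hA.pos_bound.le (norm_nonneg _)) (hA.norm_apply_le z)

lemma isInvertible [Nonempty ι] (hA : IsPositiveBilinear A p) {z : ι → ℝ} (hz : p * ‖z‖ < 1) :
    (ContinuousLinearMap.id ℝ (ι → ℝ) - A z).IsInvertible :=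
  ⟨ContinuousLinearEquiv.unitsEquiv ℝ (ι → ℝ)
    (Units.oneSub (A z) ((hA.norm_le z).trans_lt hz)), rfl⟩

/-- `I - A(z)` is a nonsingular M-matrix when `z ≥ 0` is small: it only maps nonnegative vectors
to nonnegative vectors. -/
lemma nonneg_of_sub_nonneg [Nonempty ι] (hA : IsPositiveBilinear A p) {z h : ι → ℝ} (hz : 0 ≤ z)
    (hz1 : p * ‖z‖ < 1) (hh : A z h ≤ h) : 0 ≤ h := by
  -- the negative part `m` of `h` satisfies `m ≤ A(z, m)`, which forces `m = 0`
  set m : ι → ℝ := h⁻ with hm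
  have hm0 : 0 ≤ m := negPart_nonneg h
  have hmh : -m ≤ h := neg_le.1 (neg_le_negPart h)
  have hAm : 0 ≤ A z m := hA.nonneg _ _ hz hm0
  have h1 : m ≤ A z m := by
    refine sup_le ?_ hAm
    have h2 := hA.nonneg z (h + m) hz (by simpa [neg_le_iff_add_nonneg] using hmh)
    rw [map_add] at h2
    intro i
    have h3 := h2 i
    have h4 := hh i
    simp only [Pi.zero_apply, Pi.add_apply, Pi.neg_apply] at h3 ⊢
    linarith
  have h5 : ‖m‖ ≤ p * ‖z‖ * ‖m‖ :=
    (norm_le_norm_of_nonneg_of_le hm0 h1).trans (hA.norm_apply_le z m)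
  have h6 : ‖m‖ = 0 := by
    have := norm_nonneg m
    nlinarith
  have h7 : m = 0 := norm_eq_zero.1 h6
  simpa [h7] using hmh

lemma norm_le_of_sub_eq [Nonempty ι] (hA : IsPositiveBilinear A p) {z h b : ι → ℝ} {τ : ℝ}
    (hz : p * ‖z‖ ≤ τ) (hh : h - A z h = b) : (1 - τ) * ‖h‖ ≤ ‖b‖ := by
  have h1 : ‖h‖ ≤ ‖b‖ + ‖A z h‖ := by
    rw [← hh]; simpa using norm_add_le (h - A z h) (A z h)
  have h2 := hA.norm_apply_le z h
  have h3 := mul_le_mul_of_nonneg_right hz (norm_nonneg h)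
  linarith

lemma fderiv_quad (hA : IsPositiveBilinear A p) (x : ι → ℝ) :
    fderiv ℝ (quad A) x = ContinuousLinearMap.id ℝ (ι → ℝ) - A x := by
  have h1 : HasFDerivAt (fun x => A x x) (A.precompR (ι → ℝ) x (.id ℝ _)
      + A.precompL (ι → ℝ) (.id ℝ _) x) x :=
    A.hasFDerivAt_of_bilinear (hasFDerivAt_id x) (hasFDerivAt_id x)
  have h2 := ((hasFDerivAt_id x).sub (h1.const_smul (1 / 2 : ℝ))).sub_const (1 : ι → ℝ)
  refine (h2.congr_fderiv ?_).fderiv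
  ext1 h
  have : A h x = A x h := hA.symm h x
  change h - (1 / 2 : ℝ) • (A x h + A h x) = h - A x h
  rw [this]
  module

/-- If the scalar majorant `1 + p t² / 2 - t` is nonpositive at `t`, then `quad A` has a zero
between `e` and `t e`. -/
lemma exists_zero_le [Nonempty ι] (hA : IsPositiveBilinear A p) {t : ℝ}
    (ht0 : 0 ≤ t) (ht : 1 + p / 2 * t ^ 2 ≤ t) :
    ∃ y : ι → ℝ, 1 ≤ y ∧ y ≤ (fun _ => t) ∧ quad A y = 0 := by
  have h0t : (0 : ι → ℝ) ≤ fun _ => t := fun _ => ht0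
  -- Knaster–Tarski for `x ↦ e + A(x, x) / 2` on the order interval `[0, t e]`
  let F : Set.Icc (0 : ι → ℝ) (fun _ => t) → Set.Icc (0 : ι → ℝ) (fun _ => t) := fun x =>
    ⟨1 + (1 / 2 : ℝ) • A x x, by
      have := hA.nonneg x x x.2.1 x.2.1
      have h1 : (0 : ι → ℝ) ≤ 1 := zero_le_one
      positivity, by
      intro i
      have h1 := (le_abs_self _).trans ((norm_le_pi_norm (A x x) i).trans (hA.norm_apply_le x x))
      have h2 : ‖(x : ι → ℝ)‖ ≤ t := by
        refine (norm_le_norm_of_nonneg_of_le x.2.1 x.2.2).trans ?_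
        rw [pi_norm_const, Real.norm_of_nonneg ht0]
      have h3 : p * ‖(x : ι → ℝ)‖ * ‖(x : ι → ℝ)‖ ≤ p * t * t := by
        have := hA.pos_bound
        gcongr
      simp only [Pi.add_apply, Pi.one_apply, Pi.smul_apply, smul_eq_mul]
      linarith⟩
  have hF : Monotone F := fun x y hxy => by
    have h := hA.mono x.2.1 hxy x.2.1 hxy
    refine Subtype.mk_le_mk.2 fun i => ?_
    have := h i
    simp only [Pi.add_apply, Pi.one_apply, Pi.smul_apply, smul_eq_mul]
    linarith
  have : Fact ((0 : ι → ℝ) ≤ fun _ => t) := ⟨h0t⟩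
  let y := OrderHom.lfp ⟨F, hF⟩
  have hy : F y = y := OrderHom.map_lfp ⟨F, hF⟩
  have hy' : 1 + (1 / 2 : ℝ) • A y y = (y : ι → ℝ) := congrArg Subtype.val hy
  refine ⟨y, ?_, y.2.2, ?_⟩
  · rw [← hy']
    have := hA.nonneg y y y.2.1 y.2.1
    intro i
    have := this i
    simp only [Pi.zero_apply, Pi.add_apply, Pi.one_apply, Pi.smul_apply, smul_eq_mul] at this ⊢
    linarith
  · rw [quad, sub_sub, add_comm _ (1 : ι → ℝ), hy', sub_self]

end IsPositiveBilinear

/-! ### Monotone convergence of the two-step method -/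

/-- The invariant of the two-step method for `quad A` below a zero `a`, for a pair
`(x, z) = (x_k, z_{k-1})`: the points are ordered as `0 ≤ z ≤ x < a`, and `x` is a subsolution. -/
structure Invariant (A : (ι → ℝ) →L[ℝ] (ι → ℝ) →L[ℝ] (ι → ℝ)) (a : ι → ℝ)
    (s : (ι → ℝ) × (ι → ℝ)) : Prop where
  nonneg : 0 ≤ s.2
  le : s.2 ≤ s.1
  lt : ∀ i, s.1 i < a i
  subsol : quad A s.1 ≤ 0

variable [Fintype ι] [Nonempty ι]

/-- One step of the two-step method keeps the invariant and squares the error. The two exact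
identities behind this, with `m = (x + a) / 2`, predictor `y`, new iterate `x'`
and `z' = (x + y) / 2`, are
`(I - A(z)) (a - y) = A(m - z) (a - x)` and `(I - A(z')) (a - x') = A(a - y) (a - x) / 2`. -/
lemma Invariant.step (hA : IsPositiveBilinear A p) {a : ι → ℝ} (ha : quad A a = 0)
    (hpa : p * ‖a‖ ≤ 0.425) {s : (ι → ℝ) × (ι → ℝ)} (hs : Invariant A a s) :
    Invariant A a (TwoStepNewton.step (quad A) s) ∧
      ‖a - (TwoStepNewton.step (quad A) s).1‖ ≤ 0.643 * p * ‖a - s.1‖ ^ 2 := by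
  obtain ⟨x, z⟩ := s
  obtain ⟨hz, hzx, hxa, hsub⟩ := hs
  simp only at hz hzx hxa hsub ⊢
  have hp := hA.pos_bound
  have hsmall {b : ι → ℝ} (hb : 0 ≤ b) (hba : b ≤ a) : p * ‖b‖ ≤ 0.425 :=
    (mul_le_mul_of_nonneg_left (norm_le_norm_of_nonneg_of_le hb hba) hp.le).trans hpa
  have hxa' : x ≤ a := fun i => (hxa i).le
  have hpz := hsmall hz (hzx.trans hxa')
  have hinv {b : ι → ℝ} (hb : p * ‖b‖ ≤ 0.425) :
      (fderiv ℝ (quad A) b).IsInvertible := by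
    rw [hA.fderiv_quad]
    exact hA.isInvertible (by linarith)
  have hsolve {b : ι → ℝ} (hb : p * ‖b‖ ≤ 0.425) :
      -(fderiv ℝ (quad A) b).inverse (quad A x)
        - A b (-(fderiv ℝ (quad A) b).inverse (quad A x)) = -quad A x := by
    have h1 := (hinv hb).self_apply_inverse (quad A x)
    have h2 := DFunLike.congr_fun (hA.fderiv_quad b)
      ((fderiv ℝ (quad A) b).inverse (quad A x))
    rw [h1, sub_apply, id_apply] at h2
    rw [map_neg, sub_neg_eq_add, neg_add_eq_sub, ← neg_sub, ← h2]
  set g := quad A x with hg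
  set d := a - x with hd
  set m := (1 / 2 : ℝ) • (x + a) with hm
  have hd0 : 0 ≤ d := sub_nonneg.2 hxa'
  have hdpos : ∀ i, 0 < d i := fun i => sub_pos.2 (hxa i)
  have hgd : g = A m d - d := by
    have := hA.quad_sub_quad x a
    rw [ha, zero_sub, ← hg, ← hd, ← hm] at this
    rw [← neg_neg g, this]; abel
  have hzm : (1 / 2 : ℝ) • d ≤ m - z := by
    intro i
    have := hzx i
    simp only [hd, hm, Pi.smul_apply, Pi.add_apply, Pi.sub_apply, smul_eq_mul]
    linarith
  have hmzpos : ∀ i, 0 < (m - z) i := fun i => by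
    have h1 := hzm i
    have h2 := hdpos i
    simp only [Pi.smul_apply, smul_eq_mul] at h1
    linarith
  have hmz0 : 0 ≤ m - z := fun i => (hmzpos i).le
  have hmza : m - z ≤ a := by
    intro i
    have h1 := hz i
    have h2 := hxa' i
    simp only [hm, Pi.smul_apply, Pi.add_apply, Pi.sub_apply, smul_eq_mul, Pi.zero_apply] at h1 ⊢
    linarith
  -- the predictor increment `η = y - x`
  set η := -(fderiv ℝ (quad A) z).inverse g with hη
  have hηeq : η - A z η = -g := hsolve hpz
  have hη0 : 0 ≤ η := hA.nonneg_of_sub_nonneg hz (by linarith)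
    (sub_nonneg.1 (by rw [hηeq]; exact neg_nonneg.2 hsub))
  have heeq : (d - η) - A z (d - η) = A (m - z) d := by
    have : (d - η) - A z (d - η) = d - A z d - (η - A z η) := by rw [map_sub]; abel
    rw [this, hηeq, hgd, map_sub A m z, sub_apply]; abel
  have he0 : 0 ≤ d - η := hA.nonneg_of_sub_nonneg hz (by linarith)
    (sub_nonneg.1 (by rw [heeq]; exact hA.nonneg _ _ hmz0 hd0))
  have hepos : ∀ i, 0 < (d - η) i := fun i => by
    have h1 := hA.pos _ _ hmzpos hdpos i
    have h2 := hA.nonneg _ _ hz he0 i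
    have h3 := congrFun heeq i
    simp only [Pi.zero_apply] at h2
    rw [Pi.sub_apply (d - η)] at h3
    linarith
  -- the midpoint `z'`
  have hmid : TwoStepNewton.midpoint (quad A) z x = x + (1 / 2 : ℝ) • η := by
    simp only [TwoStepNewton.midpoint, TwoStepNewton.predictor, hη, ← hg]
    module
  simp only [TwoStepNewton.step, hmid, ← hg]
  set z' := x + (1 / 2 : ℝ) • η with hz'
  have hxz' : x ≤ z' := le_add_of_nonneg_right (smul_nonneg (by norm_num) hη0)
  have hz'0 : 0 ≤ z' := hz.trans (hzx.trans hxz')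
  have hmz' : m - z' = (1 / 2 : ℝ) • (d - η) := by
    simp only [hm, hz', hd]; module
  have hz'a : z' ≤ a := by
    intro i
    have h1 := he0 i
    have h2 := hxa' i
    simp only [hz', hd, Pi.smul_apply, Pi.add_apply, Pi.sub_apply, smul_eq_mul, Pi.zero_apply]
      at h1 ⊢
    linarith
  have hpz' := hsmall hz'0 hz'a
  -- the corrector increment `σ = x' - x`
  set σ := -(fderiv ℝ (quad A) z').inverse g with hσ
  have hx' : x - (fderiv ℝ (quad A) z').inverse g = x + σ := sub_eq_add_neg _ _
  have hσeq : σ - A z' σ = -g := hsolve hpz'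
  have hσ0 : 0 ≤ σ := hA.nonneg_of_sub_nonneg hz'0 (by linarith)
    (sub_nonneg.1 (by rw [hσeq]; exact neg_nonneg.2 hsub))
  have hd'eq : (d - σ) - A z' (d - σ) = (1 / 2 : ℝ) • A (d - η) d := by
    have : (d - σ) - A z' (d - σ) = d - A z' d - (σ - A z' σ) := by rw [map_sub]; abel
    have h2 : (1 / 2 : ℝ) • A (d - η) d = A (m - z') d := by
      rw [hmz', map_smul, smul_apply]
    rw [this, h2, hσeq, hgd, map_sub A m z', sub_apply]; abel
  have hAe := hA.nonneg _ _ he0 hd0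
  have hd'0 : 0 ≤ d - σ := hA.nonneg_of_sub_nonneg hz'0 (by linarith)
    (sub_nonneg.1 (by rw [hd'eq]; exact smul_nonneg (by norm_num) hAe))
  have hd'pos : ∀ i, 0 < (d - σ) i := fun i => by
    have h1 := hA.pos _ _ hepos hdpos i
    have h2 := hA.nonneg _ _ hz'0 hd'0 i
    have h3 := congrFun hd'eq i
    simp only [Pi.zero_apply] at h2
    rw [Pi.sub_apply (d - σ), Pi.smul_apply, smul_eq_mul] at h3
    linarith
  have hση : 0 ≤ σ - η := by
    refine hA.nonneg_of_sub_nonneg hz (by linarith) (sub_nonneg.1 ?_)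
    have : (σ - η) - A z (σ - η) = A (z' - z) σ := by
      have h1 : (σ - η) - A z (σ - η)
          = (σ - A z' σ) - (η - A z η) + (A z' σ - A z σ) := by rw [map_sub]; abel
      rw [h1, hσeq, hηeq, map_sub A z' z, sub_apply]; abel
    rw [this]
    exact hA.nonneg _ _ (sub_nonneg.2 (hzx.trans hxz')) hσ0
  have ha' : a - (x + σ) = d - σ := by rw [hd]; abel
  rw [hx']
  refine ⟨⟨hz'0, ?_, fun i => ?_, ?_⟩, ?_⟩
  · intro i
    have h1 := hση i
    have h2 := hη0 i
    simp only [hz', Pi.smul_apply, Pi.add_apply, Pi.sub_apply, smul_eq_mul, Pi.zero_apply]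
      at h1 h2 ⊢
    linarith
  · have := hd'pos i
    simp only [hd, Pi.sub_apply, Pi.add_apply] at this ⊢
    linarith
  · -- `g(x + σ) = -A(σ - η, σ) / 2`
    have h1 := hA.quad_sub_quad x (x + σ)
    rw [add_sub_cancel_left, ← hg] at h1
    have h2 : quad A (x + σ) = -((1 / 2 : ℝ) • A (σ - η) σ) := by
      have h3 : (1 / 2 : ℝ) • (x + (x + σ)) = z' + (1 / 2 : ℝ) • (σ - η) := by
        rw [hz']; module
      rw [h3, map_add, add_apply, map_smul, smul_apply] at h1
      rw [← sub_add_cancel (quad A (x + σ)) g, h1, ← neg_neg g, ← hσeq]; abel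
    rw [h2]
    exact neg_nonpos.2 (smul_nonneg (by norm_num) (hA.nonneg _ _ hση hσ0))
  · rw [ha']
    have h1 := hA.norm_le_of_sub_eq hpz heeq
    have h2 := hA.norm_le_of_sub_eq hpz' hd'eq
    have h3 := hA.norm_apply_le (m - z) d
    have h4 := hA.norm_apply_le (d - η) d
    have h5 := mul_le_mul_of_nonneg_right (hsmall hmz0 hmza) (norm_nonneg d)
    rw [norm_smul, Real.norm_of_nonneg (by norm_num : (0 : ℝ) ≤ 1 / 2)] at h2
    have h6 : ‖d - η‖ ≤ 0.425 / 0.575 * ‖d‖ := by linarith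
    have h7 := mul_le_mul_of_nonneg_left h6 (mul_nonneg hp.le (norm_nonneg d))
    have h8 : 0 ≤ p * ‖d‖ ^ 2 := by positivity
    linarith

open TwoStepNewton

/-! ### Convergence and error bounds -/

lemma Invariant.state (hA : IsPositiveBilinear A p) {a : ι → ℝ} (ha0 : ∀ i, 0 < a i)
    (ha : quad A a = 0) (hpa : p * ‖a‖ ≤ 0.425) (k : ℕ) :
    Invariant A a (TwoStepNewton.state (quad A) 0 k) := by
  induction k with
  | zero =>
    refine ⟨le_rfl, le_rfl, ha0, ?_⟩
    simp [TwoStepNewton.state, quad]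
  | succ k ih =>
    rw [TwoStepNewton.state, Function.iterate_succ_apply']
    exact (ih.step hA ha hpa).1

lemma norm_sub_iter_succ_le (hA : IsPositiveBilinear A p) {a : ι → ℝ} (ha0 : ∀ i, 0 < a i)
    (ha : quad A a = 0) (hpa : p * ‖a‖ ≤ 0.425) (k : ℕ) :
    ‖a - iter (quad A) 0 (k + 1)‖ ≤ 0.643 * p * ‖a - iter (quad A) 0 k‖ ^ 2 := by
  have := ((Invariant.state hA ha0 ha hpa k).step hA ha hpa).2
  rwa [iter, TwoStepNewton.state, Function.iterate_succ_apply']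

lemma Invariant.bound_sub (hA : IsPositiveBilinear A p) {a : ι → ℝ}
    (hpa : p * ‖a‖ ≤ 0.425) {s : (ι → ℝ) × (ι → ℝ)} (hs : Invariant A a s) :
    p * ‖a - s.1‖ ≤ 0.425 :=
  (mul_le_mul_of_nonneg_left (norm_le_norm_of_nonneg_of_le
    (fun i => (sub_pos.2 (hs.lt i)).le) (sub_le_self a (hs.nonneg.trans hs.le)))
    hA.pos_bound.le).trans hpa

lemma wellDefined (hA : IsPositiveBilinear A p) {a : ι → ℝ} (ha0 : ∀ i, 0 < a i)
    (ha : quad A a = 0) (hpa : p * ‖a‖ ≤ 0.425) : WellDefined (quad A) 0 := by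
  intro k
  have hs := Invariant.state hA ha0 ha hpa k
  rw [hA.fderiv_quad]
  refine hA.isInvertible (lt_of_le_of_lt ((mul_le_mul_of_nonneg_left
    (norm_le_norm_of_nonneg_of_le hs.nonneg ?_) hA.pos_bound.le).trans hpa) (by norm_num))
  exact hs.le.trans fun i => (hs.lt i).le

lemma convergesQQuadratically (hA : IsPositiveBilinear A p) {a : ι → ℝ} (ha0 : ∀ i, 0 < a i)
    (ha : quad A a = 0) (hpa : p * ‖a‖ ≤ 0.425) :
    ConvergesQQuadratically (iter (quad A) 0) a := by
  have hp := hA.pos_bound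
  have hq := norm_sub_iter_succ_le hA ha0 ha hpa
  have hgeom (k : ℕ) : ‖a - iter (quad A) 0 k‖ ≤ (1 / 2) ^ k * ‖a‖ := by
    induction k with
    | zero => simp [iter, TwoStepNewton.state]
    | succ k ih =>
      have h1 := mul_le_mul_of_nonneg_right
        ((Invariant.state hA ha0 ha hpa k).bound_sub hA hpa)
        (norm_nonneg (a - iter (quad A) 0 k))
      change p * ‖a - iter (quad A) 0 k‖ * ‖a - iter (quad A) 0 k‖ ≤ _ at h1
      have h2 := hq k
      have h3 := norm_nonneg (a - iter (quad A) 0 k)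
      rw [pow_succ]
      linarith
  refine ⟨?_, 0.643 * p, by positivity, fun k => ?_⟩
  · rw [tendsto_iff_norm_sub_tendsto_zero]
    refine squeeze_zero (fun _ => norm_nonneg _)
      (fun k => (norm_sub_rev _ _).trans_le (hgeom k)) ?_
    simpa using (tendsto_pow_atTop_nhds_zero_of_lt_one (r := (1 / 2 : ℝ))
      (by norm_num) (by norm_num)).mul_const ‖a‖
  · rw [norm_sub_rev, norm_sub_rev _ a]
    exact hq k

/-- The new error is at most `0.643 p ‖a - x_k‖ ^ 2 ≤ 0.274 ‖a - x_k‖`, so the increment is at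
least `0.726 ‖a - x_k‖`, and `0.643 < 1.32 * 0.726 ^ 2`. The inequality is strict because the
errors stay componentwise positive. -/
lemma norm_sub_iter_succ_lt (hA : IsPositiveBilinear A p) {a : ι → ℝ} (ha0 : ∀ i, 0 < a i)
    (ha : quad A a = 0) (hpa : p * ‖a‖ ≤ 0.425) (k : ℕ) :
    ‖a - iter (quad A) 0 (k + 1)‖ <
      1.32 * p * ‖iter (quad A) 0 (k + 1) - iter (quad A) 0 k‖ ^ 2 := by
  have hp := hA.pos_bound
  have hs := Invariant.state hA ha0 ha hpa k
  have h1 := norm_sub_iter_succ_le hA ha0 ha hpa k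
  have h2 := hs.bound_sub hA hpa
  change p * ‖a - iter (quad A) 0 k‖ ≤ _ at h2
  have hD : 0 < ‖a - iter (quad A) 0 k‖ := by
    refine norm_pos_iff.2 fun h => ?_
    have i := Classical.arbitrary ι
    exact (sub_pos.2 (hs.lt i)).ne' (congrFun h i)
  have h3 : ‖a - iter (quad A) 0 k‖ ≤ ‖a - iter (quad A) 0 (k + 1)‖
      + ‖iter (quad A) 0 (k + 1) - iter (quad A) 0 k‖ := norm_sub_le_norm_sub_add_norm_sub ..
  set D := ‖a - iter (quad A) 0 k‖
  set S := ‖iter (quad A) 0 (k + 1) - iter (quad A) 0 k‖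
  have h4 := mul_le_mul_of_nonneg_right h2 hD.le
  have h5 : 0.726 * D ≤ S := by linarith
  have h6 : (0.726 * D) ^ 2 ≤ S ^ 2 := pow_le_pow_left₀ (by positivity) h5 2
  have h7 := mul_le_mul_of_nonneg_left h6 hp.le
  have h8 : 0 < p * D ^ 2 := by positivity
  linarith

/-- The least positive zero of `quad A` lies strictly below `t e` for every positive `t` at which
the scalar majorant `1 + p t² / 2 - t` is nonpositive. -/
lemma IsPositiveBilinear.least_zero_lt (hA : IsPositiveBilinear A p) {a : ι → ℝ}
    (ha : IsLeast {y : ι → ℝ | (∀ i, 0 < y i) ∧ quad A y = 0} a) {t : ℝ} (ht0 : 0 < t)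
    (ht : 1 + p / 2 * t ^ 2 ≤ t) : ‖a‖ < t := by
  obtain ⟨y, hy1, hyt, hy⟩ := hA.exists_zero_le ht0.le ht
  have hat : a ≤ fun _ => t :=
    (ha.2 ⟨fun i => zero_lt_one.trans_le (hy1 i), hy⟩).trans hyt
  have ha0 : 0 ≤ a := fun i => (ha.1.1 i).le
  refine (pi_norm_lt_iff ht0).2 fun i => ?_
  rw [Real.norm_of_nonneg (ha0 i)]
  -- strictness comes from the components of `A(e, e)` being strictly below `p`
  have h1 := hA.mono ha0 hat ha0 hat i
  have h2 : A (fun _ => t) (fun _ => t) i = t ^ 2 * A 1 1 i := by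
    have : (fun _ => t : ι → ℝ) = t • 1 := by ext; simp
    rw [this]; simp only [map_smul, smul_apply, Pi.smul_apply, smul_eq_mul]; ring
  have h3 := mul_lt_mul_of_pos_left (hA.one_one_lt i) (pow_pos ht0 2)
  have h4 := congrFun ha.1.2 i
  simp only [quad, Pi.sub_apply, Pi.smul_apply, smul_eq_mul, Pi.one_apply, Pi.zero_apply] at h4
  linarith

end PositiveQuadratic

/-! ### The discretized transport Riccati equation -/

namespace TransportRiccati

variable {n : ℕ}

/-- The polar form `A(x, y) = b(x, y) + b(y, x)` of the quadratic part of `f`, where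
`b(x, y) = [u_x ∘ (P v_y); v_x ∘ (P̃ u_y)]`. -/
def polar (c α : ℝ) (ω w : Fin n → ℝ) : Vec n →L[ℝ] Vec n →L[ℝ] Vec n :=
  LinearMap.toContinuousBilinearMap <| LinearMap.mk₂ ℝ
    (fun x y => Sum.elim
      (fun i => x (.inl i) * (P c α ω w).mulVec (fun j => y (.inr j)) i
        + y (.inl i) * (P c α ω w).mulVec (fun j => x (.inr j)) i)
      (fun i => x (.inr i) * (Ptilde c α ω w).mulVec (fun j => y (.inl j)) i
        + y (.inr i) * (Ptilde c α ω w).mulVec (fun j => x (.inl j)) i))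
    (fun x x' y => by
      ext (i | i) <;> simp [Matrix.mulVec, dotProduct, mul_add, Finset.sum_add_distrib] <;> ring)
    (fun r x y => by
      ext (i | i) <;> simp [Matrix.mulVec, dotProduct, mul_left_comm _ r, ← Finset.mul_sum] <;>
        ring)
    (fun x y y' => by
      ext (i | i) <;> simp [Matrix.mulVec, dotProduct, mul_add, Finset.sum_add_distrib] <;> ring)
    (fun r x y => by
      ext (i | i) <;> simp [Matrix.mulVec, dotProduct, mul_left_comm _ r, ← Finset.mul_sum] <;>
        ring)

lemma polar_inl (c α : ℝ) (ω w : Fin n → ℝ) (x y : Vec n) (i : Fin n) :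
    polar c α ω w x y (.inl i) = x (.inl i) * (P c α ω w).mulVec (fun j => y (.inr j)) i
        + y (.inl i) * (P c α ω w).mulVec (fun j => x (.inr j)) i := rfl

lemma polar_inr (c α : ℝ) (ω w : Fin n → ℝ) (x y : Vec n) (i : Fin n) :
    polar c α ω w x y (.inr i) = x (.inr i) * (Ptilde c α ω w).mulVec (fun j => y (.inl j)) i
        + y (.inr i) * (Ptilde c α ω w).mulVec (fun j => x (.inl j)) i := rfl

lemma f_eq_quad (c α : ℝ) (ω w : Fin n → ℝ) :
    f c α ω w = PositiveQuadratic.quad (polar c α ω w) := by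
  ext x (i | i) <;>
    simp only [f, PositiveQuadratic.quad, Pi.sub_apply, Pi.smul_apply, smul_eq_mul, Pi.one_apply,
      polar_inl, polar_inr, Sum.elim_inl, Sum.elim_inr] <;> ring

section

variable {c α : ℝ} {ω w : Fin n → ℝ}

lemma P_pos (hc : 0 < c) (hα : 0 ≤ α) (hα1 : α < 1) (hω : ∀ i, 0 < ω i) (hw : ∀ i, 0 < w i)
    (i j : Fin n) : 0 < P c α ω w i j := by
  have := hω i; have := hω j; have := hw j; have : 0 < 1 - α := by linarith
  simp only [P, Matrix.of_apply, q, delta, gamma]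
  positivity

lemma Ptilde_pos (hc : 0 < c) (hα : 0 ≤ α) (hα1 : α < 1) (hω : ∀ i, 0 < ω i)
    (hw : ∀ i, 0 < w i) (i j : Fin n) : 0 < Ptilde c α ω w i j := by
  have := hω i; have := hω j; have := hw j; have : 0 < 1 - α := by linarith
  simp only [Ptilde, Matrix.of_apply, q, delta, gamma]
  positivity

/-- Dropping `δ_i > 0` from the denominator leaves `q_j / γ_j = c (1 - α) w_j / 2`. -/
lemma P_lt (hc : 0 < c) (hα : 0 ≤ α) (hα1 : α < 1) (hω : ∀ i, 0 < ω i) (hw : ∀ i, 0 < w i)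
    (i j : Fin n) : P c α ω w i j < c * (1 + α) / 2 * w j := by
  have hi := hω i; have hj := hω j; have hwj := hw j; have h1 : 0 < 1 - α := by linarith
  have h2 : 0 < delta c α ω i := by rw [delta]; positivity
  have h3 : 0 < gamma c α ω j := by rw [gamma]; positivity
  have h4 : 0 < q ω w j := by rw [q]; positivity
  calc P c α ω w i j < q ω w j / gamma c α ω j :=
        div_lt_div_of_pos_left h4 h3 (by linarith)
    _ = c * (1 - α) / 2 * w j := by rw [q, gamma]; field_simp
    _ ≤ c * (1 + α) / 2 * w j := by gcongr; linarith

/-- Dropping `γ_i > 0` from the denominator leaves `q_j / δ_j = c (1 + α) w_j / 2`. -/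
lemma Ptilde_lt (hc : 0 < c) (hα : 0 ≤ α) (hα1 : α < 1) (hω : ∀ i, 0 < ω i) (hw : ∀ i, 0 < w i)
    (i j : Fin n) : Ptilde c α ω w i j < c * (1 + α) / 2 * w j := by
  have hi := hω i; have hj := hω j; have hwj := hw j; have h1 : 0 < 1 - α := by linarith
  have h2 : 0 < delta c α ω j := by rw [delta]; positivity
  have h3 : 0 < gamma c α ω i := by rw [gamma]; positivity
  have h4 : 0 < q ω w j := by rw [q]; positivity
  calc Ptilde c α ω w i j < q ω w j / delta c α ω j :=
        div_lt_div_of_pos_left h4 h2 (by linarith)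
    _ = c * (1 + α) / 2 * w j := by rw [q, delta]; field_simp

lemma isPositiveBilinear_polar [NeZero n] (hc : 0 < c) (hα : 0 ≤ α) (hα1 : α < 1)
    (hω : ∀ i, 0 < ω i) (hw : ∀ i, 0 < w i) (hw_sum : ∑ i, w i = 1) :
    PositiveQuadratic.IsPositiveBilinear (polar c α ω w) (c * (1 + α)) := by
  have hP := P_pos hc hα hα1 hω hw
  have hPt := Ptilde_pos hc hα hα1 hω hw
  have hnonneg {B : Matrix (Fin n) (Fin n) ℝ} (hB : ∀ i j, 0 < B i j) {y : Fin n → ℝ}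
      (hy : ∀ j, 0 ≤ y j) (i : Fin n) : 0 ≤ B.mulVec y i := by
    rw [Matrix.mulVec, dotProduct]
    exact Finset.sum_nonneg fun j _ => mul_nonneg (hB i j).le (hy j)
  have hpos {B : Matrix (Fin n) (Fin n) ℝ} (hB : ∀ i j, 0 < B i j) {y : Fin n → ℝ}
      (hy : ∀ j, 0 < y j) (i : Fin n) : 0 < B.mulVec y i := by
    rw [Matrix.mulVec, dotProduct]
    exact Finset.sum_pos (fun j _ => mul_pos (hB i j) (hy j)) Finset.univ_nonempty
  have hone {B : Matrix (Fin n) (Fin n) ℝ} (hB : ∀ i j, B i j < c * (1 + α) / 2 * w j)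
      (i : Fin n) : B.mulVec (fun _ => 1) i < c * (1 + α) / 2 := by
    calc B.mulVec (fun _ => 1) i = ∑ j, B i j := by simp [Matrix.mulVec, dotProduct]
      _ < ∑ j, c * (1 + α) / 2 * w j :=
        Finset.sum_lt_sum_of_nonempty Finset.univ_nonempty fun j _ => hB i j
      _ = c * (1 + α) / 2 := by rw [← Finset.mul_sum, hw_sum, mul_one]
  refine ⟨fun x y => ?_, fun x y hx hy => ?_, fun x y hx hy => ?_, ?_⟩
  · ext (i | i) <;> simp only [polar_inl, polar_inr, add_comm]
  · rintro (i | i)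
    · exact add_nonneg (mul_nonneg (hx _) (hnonneg hP (fun _ => hy _) i))
        (mul_nonneg (hy _) (hnonneg hP (fun _ => hx _) i))
    · exact add_nonneg (mul_nonneg (hx _) (hnonneg hPt (fun _ => hy _) i))
        (mul_nonneg (hy _) (hnonneg hPt (fun _ => hx _) i))
  · rintro (i | i)
    · exact add_pos (mul_pos (hx _) (hpos hP (fun _ => hy _) i))
        (mul_pos (hy _) (hpos hP (fun _ => hx _) i))
    · exact add_pos (mul_pos (hx _) (hpos hPt (fun _ => hy _) i))
        (mul_pos (hy _) (hpos hPt (fun _ => hx _) i))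
  · rintro (i | i)
    · have := hone (P_lt hc hα hα1 hω hw) i
      simp only [polar_inl, Pi.one_apply]
      linarith
    · have := hone (Ptilde_lt hc hα hα1 hω hw) i
      simp only [polar_inr, Pi.one_apply]
      linarith

end

end TransportRiccati

end

theorem mainTheorem2 (n : ℕ) (c α : ℝ) (hc : 0 < c) (hc1 : c ≤ 1) (hα : 0 ≤ α) (hα1 : α < 1)
    (ω w : Fin n → ℝ) (hω_anti : StrictAnti ω) (hω_pos : ∀ i, 0 < ω i) (hω_lt : ∀ i, ω i < 1)
    (hw_pos : ∀ i, 0 < w i) (hw_sum : ∑ i, w i = 1)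
    (xstar : TransportRiccati.Vec n)
    (hxstar : TransportRiccati.IsMinimalPositiveSolution c α ω w xstar)
    (hnonsing : α ≠ 0 ∨ c ≠ 1)
    (hcα : c * (1 + α) ≤ 1 / 3) :
    TwoStepNewton.WellDefined (TransportRiccati.f c α ω w) 0 ∧
    TwoStepNewton.ConvergesQQuadratically
      (TwoStepNewton.iter (TransportRiccati.f c α ω w) 0) xstar ∧
    (∀ k : ℕ, 1 ≤ k →
      ‖xstar - TwoStepNewton.iter (TransportRiccati.f c α ω w) 0 k‖ <
        1.32 * c * (1 + α) *
          ‖TwoStepNewton.iter (TransportRiccati.f c α ω w) 0 k -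
            TwoStepNewton.iter (TransportRiccati.f c α ω w) 0 (k - 1)‖ ^ 2) ∧
    (∀ r : ℝ,
      (1 - Real.sqrt (1 - 2 * (c * (1 + α)))) / (c * (1 + α)) ≤ r →
      r < (1 + Real.sqrt (1 - 2 * (c * (1 + α)))) / (c * (1 + α)) →
      xstar ∈ Metric.ball (0 : TransportRiccati.Vec n) r) := by
  have hn : NeZero n := ⟨by rintro rfl; simp at hw_sum⟩
  have hA := TransportRiccati.isPositiveBilinear_polar hc hα hα1 hω_pos hw_pos hw_sum
  rw [TransportRiccati.IsMinimalPositiveSolution, TransportRiccati.f_eq_quad] at hxstar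
  rw [TransportRiccati.f_eq_quad, mul_assoc 1.32]
  set p := c * (1 + α)
  have hp := hA.pos_bound
  -- `t = 0.425 / p` is admissible for every `p ≤ 1 / 3`, as `1 / 3 + 0.425 ^ 2 / 2 < 0.425`
  have hpx : p * ‖xstar‖ ≤ 0.425 := by
    have h := hA.least_zero_lt hxstar (t := 0.425 / p) (by positivity) (by
      have : p / 2 * (0.425 / p) ^ 2 = 0.425 ^ 2 / 2 / p := by field_simp
      rw [this, ← sub_nonneg]
      have : 0.425 / p - (1 + 0.425 ^ 2 / 2 / p) = (0.425 - 0.425 ^ 2 / 2 - p) / p := by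
        field_simp; ring
      rw [this]
      exact div_nonneg (by linarith) hp.le)
    rw [lt_div_iff₀ hp] at h
    linarith
  obtain ⟨hx0, hx⟩ := hxstar.1
  refine ⟨PositiveQuadratic.wellDefined hA hx0 hx hpx,
    PositiveQuadratic.convergesQQuadratically hA hx0 hx hpx, fun k hk => ?_, fun r hr _ => ?_⟩
  · obtain ⟨k, rfl⟩ := Nat.exists_eq_add_of_le' hk
    exact PositiveQuadratic.norm_sub_iter_succ_lt hA hx0 hx hpx k
  · rw [mem_ball_zero_iff]
    -- the left end of the interval for `r` is the smaller root of `1 + p t² / 2 = t`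
    refine (hA.least_zero_lt hxstar (div_pos ?_ hp) ?_).trans_le hr
    · have : Real.sqrt (1 - 2 * p) < 1 := (Real.sqrt_lt' one_pos).2 (by linarith)
      linarith
    · have h := Real.sq_sqrt (show 0 ≤ 1 - 2 * p by linarith)
      set s := Real.sqrt (1 - 2 * p)
      refine le_of_eq ?_
      field_simp
      linarith
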